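/- **Setting.** All quantum systems are finite-dimensional and nonzero; $\mathsf D(A)$ is the set of density operators and $\mathsf S(A)$ the set of unit vectors of a system $A$. A quantum channel is a completely positive trace-preserving linear map. The trace norm is $\|L\|_1=\mathrm{Tr}\sqrt{LL^\dagger}$ and the fidelity is $F(\rho,\sigma)=\|\sqrt\rho\sqrt\sigma\|_1$. Let $\Xi$ and $H\neq\emptyset$ be finite sets, $\{\mathcal O^\xi_{A\to B}\}_{\xi\in\Xi}$ a family of quantum channels, $\{p_\xi\}_{\xi\in\Xi}$ a probability distribution, and $\{C_\eta\}_{\eta\in H}$ a family of subsets of $\Xi$ (a quantum channel group discrimination problem: an oracle $\mathcal O^\xi$ is given with probability $p_\xi$, and an answer $\eta\in H$ is correct iff $\xi\in C_\eta$). Let $R$ be a working system and $|0\rangle_{BR}$ a fixed computational basis state. An algorithm with $n$ queries consists of quantum channels $\Phi^1,\dots,\Phi^n$ from $BR$ to $AR$ and a POVM $\{M^\eta\}_{\eta\in H}$ on $BR$; writing $\mathcal O^\xi$ also for $\mathcal O^\xi\otimes\mathrm{id}_R$, put $$\rho^\xi=\mathcal O^\xi\circ\Phi^n\circ\cdots\circ\mathcal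 O^\xi\circ\Phi^1(|0\rangle\langle 0|_{BR}),\qquad p_{\mathrm{err}}(n)=\min_{\{\Phi^k\},\{M^\eta\}}\sum_{\xi\in\Xi}p_\xi\sum_{\eta:\,\xi\notin C_\eta}\mathrm{Tr}(M^\eta\rho^\xi).$$ **Theorem.** For a quantum channel $\Psi_{AR\to BR}$ and an integer $m\ge 0$ define $$\theta_{\mathcal A}(\Psi)=\arccos\min_{|\phi\rangle\in\mathsf S(AR)}\sum_{\xi\in\Xi}p_\xi F\bigl(\mathcal O^\xi(|\phi\rangle\langle\phi|),\Psi(|\phi\rangle\langle\phi|)\bigr),\qquad \theta_m=\arccos\sqrt{p_{\mathrm{err}}(m)}.$$ The minima defining $p_{\mathrm{err}}(n)$ and $\theta_{\mathcal A}(\Psi)$ are attained, and for every quantum channel $\Psi_{AR\to BR}$ and all integers $0\le m\le n$ with $(n-m)\theta_{\mathcal A}(\Psi)+\theta_m\in[0,\pi/2]$, $$p_{\mathrm{err}}(n)\ \ge\ \cos^2\bigl((n-m)\theta_{\mathcal A}(\Psi)+\theta_m\bigr).$$ Furthermore, suppose $\dim R\ge\dim A$. Let $\Psi_{A\to B}$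 be a quantum channel, $E$ a system, and $O^\xi,V:A\to B\otimes E$ linear isometries that are Stinespring representations of the channels, i.e. $\mathcal O^\xi(\rho)=\mathrm{Tr}_E(O^\xi\rho\,(O^\xi)^\dagger)$ for every $\xi\in\Xi$, and $\Psi(\rho)=\mathrm{Tr}_E(V\rho V^\dagger)$. Then $$\theta_{\mathcal A}(\Psi_{A\to B}\otimes\mathrm{id}_R)=\arccos\min_{\sigma\in\mathsf D(A)}\sum_{\xi\in\Xi}p_\xi\bigl\|\mathrm{Tr}_B\bigl(O^\xi\sigma V^\dagger\bigr)\bigr\|_1,$$ the minimum being attained. -/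

import Mathlib

open scoped ComplexOrder MatrixOrder Matrix

noncomputable section

namespace QuantumDiscrimination

/-!
A finite-dimensional quantum system `A` is given by a finite type `A` indexing its computational
basis, so that its dimension is `Fintype.card A`; the composite system of `A` and `R` is `A × R`.
-/

/-- The linear operators on the quantum system `A`. -/
abbrev Op (A : Type*) := Matrix A A ℂ

/-- `ρ` is a density operator. -/
def IsDensity {A : Type*} [Fintype A] (ρ : Op A) : Prop :=
  ρ.PosSemidef ∧ ρ.trace = 1

/-- `φ` is a state vector, i.e. a unit vector of the Hilbert space of the system `A`. -/
def IsStateVector {A : Type*} [Fintype A] (φ : A → ℂ) : Prop :=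
  star φ ⬝ᵥ φ = 1

/-- The operator `|φ⟩⟨φ|`. -/
def ketBra {A : Type*} (φ : A → ℂ) : Op A :=
  Matrix.vecMulVec φ (star φ)

/-- The trace norm `Tr √(L L†)`. -/
def traceNorm {A : Type*} [Fintype A] [DecidableEq A] (L : Op A) : ℝ :=
  (CFC.sqrt (L * Lᴴ)).trace.re

/-- The (square root) fidelity `‖√ρ √σ‖₁`. -/
def fidelity {A : Type*} [Fintype A] [DecidableEq A] (ρ σ : Op A) : ℝ :=
  traceNorm (CFC.sqrt ρ * CFC.sqrt σ)

/-- The partial trace over the first tensor factor. -/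
def traceFst {B E : Type*} [Fintype B] (X : Op (B × E)) : Op E :=
  Matrix.of fun e e' => ∑ b, X (b, e) (b, e')

/-- The partial trace over the second tensor factor. -/
def traceSnd {B E : Type*} [Fintype E] (X : Op (B × E)) : Op B :=
  Matrix.of fun b b' => ∑ e, X (b, e) (b', e)

/-- The map `Φ ⊗ id_R`, acting as `Φ` on each `A`-block of an operator on `A × R`. -/
def tensorId {A B : Type*} (R : Type*) (Φ : Op A →ₗ[ℂ] Op B) : Op (A × R) →ₗ[ℂ] Op (B × R) where
  toFun X := Matrix.of fun i j => Φ (Matrix.of fun a a' => X (a, i.2) (a', j.2)) i.1 j.1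
  map_add' X Y := by
    ext i j
    exact congrFun (congrFun (Φ.map_add (Matrix.of fun a a' => X (a, i.2) (a', j.2))
      (Matrix.of fun a a' => Y (a, i.2) (a', j.2))) i.1) j.1
  map_smul' c X := by
    ext i j
    exact congrFun (congrFun (Φ.map_smul c (Matrix.of fun a a' => X (a, i.2) (a', j.2))) i.1) j.1

/-- A quantum channel: a completely positive trace preserving linear map. -/
def IsChannel {A B : Type*} [Fintype A] [Fintype B] (Φ : Op A →ₗ[ℂ] Op B) : Prop :=
  (∀ (k : ℕ) (X : Op (A × Fin k)), X.PosSemidef → (tensorId (Fin k) Φ X).PosSemidef) ∧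
    ∀ X : Op A, (Φ X).trace = X.trace

/-- `V` is an isometry from `A` to `B ⊗ E` that is a Stinespring representation of `Φ`. -/
def IsStinespring {A B E : Type*} [Fintype A] [Fintype B] [Fintype E] [DecidableEq A]
    (Φ : Op A →ₗ[ℂ] Op B) (V : Matrix (B × E) A ℂ) : Prop :=
  Vᴴ * V = 1 ∧ ∀ X : Op A, Φ X = traceSnd (V * X * Vᴴ)

/-- A positive operator-valued measure on the system `A` with outcomes in `H`. -/
def IsPOVM {H A : Type*} [Fintype H] [DecidableEq A] (M : H → Op A) : Prop :=
  (∀ η, (M η).PosSemidef) ∧ ∑ η, M η = 1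

/-- A quantum channel group discrimination problem: a finite family of channels `O ξ` from `A`
to `B`, a probability distribution `p` on the index set `Ξ`, and subsets `C η` of `Ξ`. The answer
`η` is correct for the oracle `O ξ` iff `ξ ∈ C η`. -/
structure QCGDP (Ξ H A B : Type*) [Fintype Ξ] [Fintype A] [Fintype B] where
  /-- the prior probabilities -/
  p : Ξ → ℝ
  p_nonneg : ∀ ξ, 0 ≤ p ξ
  p_sum : ∑ ξ, p ξ = 1
  /-- the oracles -/
  O : Ξ → Op A →ₗ[ℂ] Op B
  O_channel : ∀ ξ, IsChannel (O ξ)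
  /-- the groups -/
  C : H → Finset Ξ

/-- The state obtained from the basis state `|z⟩⟨z|` of `B ⊗ R` by applying, for `k = 1, …, n`,
first `Φ k` and then `oracle ⊗ id_R`. -/
def finalState {A B R : Type*} [DecidableEq B] [DecidableEq R]
    (oracle : Op A →ₗ[ℂ] Op B) (z : B × R) :
    (n : ℕ) → (Fin n → Op (B × R) →ₗ[ℂ] Op (A × R)) → Op (B × R)
  | 0, _ => Matrix.single z z 1
  | n + 1, Φ =>
      tensorId R oracle (Φ (Fin.last n) (finalState oracle z n fun k => Φ k.castSucc))

namespace QCGDP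

variable {Ξ H A B R : Type*} [Fintype Ξ] [DecidableEq Ξ] [Fintype H] [Fintype A] [Fintype B]
  [Fintype R] [DecidableEq A] [DecidableEq B] [DecidableEq R]

/-- The error probability of the algorithm `(Φ, M)` with `n` queries. -/
def errorProb (Q : QCGDP Ξ H A B) (z : B × R) {n : ℕ}
    (Φ : Fin n → Op (B × R) →ₗ[ℂ] Op (A × R)) (M : H → Op (B × R)) : ℝ :=
  ∑ ξ, Q.p ξ * ∑ η with ξ ∉ Q.C η, (M η * finalState (Q.O ξ) z n Φ).trace.re

/-- The error probabilities of all algorithms with `n` queries and working system `R`. -/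
def errorProbs (Q : QCGDP Ξ H A B) (z : B × R) (n : ℕ) : Set ℝ :=
  {e | ∃ (Φ : Fin n → Op (B × R) →ₗ[ℂ] Op (A × R)) (M : H → Op (B × R)),
    (∀ k, IsChannel (Φ k)) ∧ IsPOVM M ∧ e = Q.errorProb z Φ M}

/-- The minimum error probability with `n` queries. -/
def pErr (Q : QCGDP Ξ H A B) (z : B × R) (n : ℕ) : ℝ :=
  sInf (Q.errorProbs z n)

/-- The angle `θ_m = arccos √(p_err(m))`. -/
def theta (Q : QCGDP Ξ H A B) (z : B × R) (m : ℕ) : ℝ :=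
  Real.arccos (Real.sqrt (Q.pErr z m))

/-- The averaged fidelities of the outputs of the oracles and of `Ψ` over all pure inputs. -/
def avgFidelities (Q : QCGDP Ξ H A B) (Ψ : Op (A × R) →ₗ[ℂ] Op (B × R)) : Set ℝ :=
  {f | ∃ φ : A × R → ℂ, IsStateVector φ ∧
    f = ∑ ξ, Q.p ξ * fidelity (tensorId R (Q.O ξ) (ketBra φ)) (Ψ (ketBra φ))}

/-- The angle `θ_𝒜(Ψ)`, the arccosine of the minimum averaged fidelity. -/
def thetaA (Q : QCGDP Ξ H A B) (Ψ : Op (A × R) →ₗ[ℂ] Op (B × R)) : ℝ :=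
  Real.arccos (sInf (Q.avgFidelities Ψ))

/-- The averaged trace norms `∑ p ξ ‖Tr_B (W ξ σ V†)‖₁` over all density operators `σ`. -/
def avgTraceNorms {E : Type*} [Fintype E] [DecidableEq E] (Q : QCGDP Ξ H A B)
    (W : Ξ → Matrix (B × E) A ℂ) (V : Matrix (B × E) A ℂ) : Set ℝ :=
  {t | ∃ σ : Op A, IsDensity σ ∧ t = ∑ ξ, Q.p ξ * traceNorm (traceFst (W ξ * σ * Vᴴ))}

end QCGDP

end QuantumDiscrimination

end

/-!
The lower bound is proved one query at a time: `theta_succ_le` states that an additional query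
lowers the angle `θ_n = arccos √(p_err(n))` by at most `θ_𝒜(Ψ)`, and the theorem follows by
iterating and taking cosines (`theta_le`, `cos_sq_le_pErr`).

For one query, take an optimal algorithm with `n + 1` queries and replace its *first* query by `Ψ`.
What remains is an algorithm with `n` queries on an initial state that does not depend on the
oracle, so its error probability `e'` is at least `p_err(n)` (`pErr_le_of_initial`). The state
before the replaced query does not depend on the oracle either; it is a mixture of pure states, and
on each of them the averaged fidelity of the outputs of the oracles and of `Ψ` is at least
`cos θ_𝒜(Ψ)`. Pulling the event "the answer is wrong" back through the remaining rounds gives, for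
every oracle, a two-outcome measurement of these outputs. Fidelity is at most the Bhattacharyya
coefficient of the outcome distributions (`fidelity_le_bhattacharyya`), and by Cauchy–Schwarz the
average of these coefficients is at most the coefficient of `(e, 1 - e)` and `(e', 1 - e')`, with
`e = p_err(n + 1)`. The latter is the cosine of `arccos √e - arccos √e'`. Since measurement comes
first, neither the triangle inequality for the fidelity angle of states nor joint concavity of the
fidelity is needed.

The minima are attained by compactness. Channels form a compact set because the Choi operator of a
channel is positive with fixed trace (`isCompact_channelBlocks`), and the fidelity is continuous
because the square root is continuous on positive operators.

For the last formula, a Stinespring representation turns the outputs on a pure state `φ` into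
`K K†` and `L L†` with `K, L` the matrices of the dilated vectors, so that the fidelity is `‖K† L‖₁`
(`fidelity_mul_conjTranspose`), which is `‖Tr_B (O σ V†)‖₁` for the reduced state `σ` of `φ`. As
`dim A ≤ dim R`, every density operator is such a reduced state, and the two sets over which the
minima are taken coincide (`avgFidelities_tensorId`).
-/

namespace QuantumDiscrimination

open Matrix

/-! ### Trace norm and fidelity -/

/-- The Cauchy–Schwarz inequality for the Hilbert–Schmidt inner product. -/
lemma re_trace_conjTranspose_mul_le {N E : Type*} [Fintype N] [Fintype E]
    (X Y : Matrix N E ℂ) :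
    (Xᴴ * Y).trace.re ≤ √((Xᴴ * X).trace.re) * √((Yᴴ * Y).trace.re) := by
  have key : ∀ X Y : Matrix N E ℂ,
      (Xᴴ * Y).trace = ∑ q : E × N, star (X q.2 q.1) * Y q.2 q.1 := fun X Y => by
    simp [trace, mul_apply, Fintype.sum_prod_type]
  have hsq : ∀ X : Matrix N E ℂ, (Xᴴ * X).trace.re = ∑ q : E × N, ‖X q.2 q.1‖ ^ 2 := fun X => by
    rw [key, Complex.re_sum]
    refine Finset.sum_congr rfl fun q _ => ?_
    rw [Complex.star_def, Complex.conj_mul']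
    norm_cast
  rw [hsq, hsq, key]
  calc (∑ q : E × N, star (X q.2 q.1) * Y q.2 q.1).re
      ≤ ‖∑ q : E × N, star (X q.2 q.1) * Y q.2 q.1‖ := Complex.re_le_norm _
    _ ≤ ∑ q : E × N, ‖X q.2 q.1‖ * ‖Y q.2 q.1‖ :=
        (norm_sum_le _ _).trans_eq (by simp)
    _ ≤ _ := Real.sum_mul_le_sqrt_mul_sqrt _ _ _

section TraceNorm

variable {N E : Type*} [Fintype N] [DecidableEq N] [Fintype E] [DecidableEq E]

lemma sqrt_eq_real_cfc {M : Op N} (hM : M.PosSemidef) : CFC.sqrt M = cfc Real.sqrt M := by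
  rw [CFC.sqrt_eq_real_sqrt M hM.nonneg, cfcₙ_eq_cfc]

/-- The trace of `√M` depends only on the roots of the characteristic polynomial of `M`. -/
lemma trace_sqrt_eq_sum_roots {M : Op N} (hM : M.PosSemidef) :
    (CFC.sqrt M).trace = (M.charpoly.roots.map fun x => ((Real.sqrt x.re : ℝ) : ℂ)).sum := by
  rw [sqrt_eq_real_cfc hM, trace_eq_sum_roots_charpoly, hM.1.charpoly_cfc_eq,
    hM.1.roots_charpoly_eq_eigenvalues, Polynomial.roots_prod _ _
      (Finset.prod_ne_zero_iff.2 fun i _ => Polynomial.X_sub_C_ne_zero _)]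
  simp only [Polynomial.roots_X_sub_C, Multiset.bind_singleton, Multiset.map_map]
  rfl

/-- `Y Y†` and `Y† Y` have the same spectrum up to zeros, which do not contribute to the trace
of the square root. -/
lemma trace_sqrt_mul_conjTranspose_comm (Y : Matrix N E ℂ) :
    (CFC.sqrt (Y * Yᴴ)).trace = (CFC.sqrt (Yᴴ * Y)).trace := by
  rw [trace_sqrt_eq_sum_roots (posSemidef_self_mul_conjTranspose Y),
    trace_sqrt_eq_sum_roots (posSemidef_conjTranspose_mul_self Y)]
  have h := congrArg Polynomial.roots (charpoly_mul_comm' Y Yᴴ)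
  rw [Polynomial.roots_mul (mul_ne_zero (pow_ne_zero _ Polynomial.X_ne_zero)
      (charpoly_monic _).ne_zero),
    Polynomial.roots_mul (mul_ne_zero (pow_ne_zero _ Polynomial.X_ne_zero)
      (charpoly_monic _).ne_zero)] at h
  simpa [Multiset.map_nsmul, Multiset.sum_nsmul] using
    congrArg (fun s => (s.map fun x : ℂ => ((Real.sqrt x.re : ℝ) : ℂ)).sum) h

lemma traceNorm_eq_of_conjTranspose_mul (L : Op N) :
    traceNorm L = (CFC.sqrt (Lᴴ * L)).trace.re := by
  rw [traceNorm, trace_sqrt_mul_conjTranspose_comm]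

lemma traceNorm_transpose (L : Op N) : traceNorm Lᵀ = traceNorm L := by
  have h : Lᵀ * Lᵀᴴ = (Lᴴ * L)ᵀ := by
    rw [transpose_mul]; rfl
  rw [traceNorm_eq_of_conjTranspose_mul L, traceNorm, h,
    trace_sqrt_eq_sum_roots (posSemidef_conjTranspose_mul_self L).transpose, charpoly_transpose,
    ← trace_sqrt_eq_sum_roots (posSemidef_conjTranspose_mul_self L)]

/-- Uhlmann's formula for two purifications with the same purifying system `E`: if `K` and `L` are
the matrices of vectors of `N ⊗ E`, the fidelity of their reduced states on `N` is `‖K† L‖₁`. -/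
lemma fidelity_mul_conjTranspose (K L : Matrix N E ℂ) :
    fidelity (K * Kᴴ) (L * Lᴴ) = traceNorm (Kᴴ * L) := by
  have hK := posSemidef_self_mul_conjTranspose K
  have hL := posSemidef_self_mul_conjTranspose L
  set a := CFC.sqrt (K * Kᴴ) with ha
  set b := CFC.sqrt (L * Lᴴ) with hb
  have haH : aᴴ = a := (CFC.sqrt_nonneg (K * Kᴴ)).posSemidef.1
  have hbH : bᴴ = b := (CFC.sqrt_nonneg (L * Lᴴ)).posSemidef.1
  have haa : a * a = K * Kᴴ := CFC.sqrt_mul_sqrt_self _ hK.nonneg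
  have hbb : b * b = L * Lᴴ := CFC.sqrt_mul_sqrt_self _ hL.nonneg
  have h1 : (a * b)ᴴ * (a * b) = (b * K) * (b * K)ᴴ := by
    simp only [conjTranspose_mul, haH, hbH]
    rw [Matrix.mul_assoc, ← Matrix.mul_assoc a, haa]
    simp only [Matrix.mul_assoc]
  have h2 : (b * K)ᴴ * (b * K) = (Kᴴ * L) * (Kᴴ * L)ᴴ := by
    simp only [conjTranspose_mul, hbH, conjTranspose_conjTranspose]
    rw [Matrix.mul_assoc, ← Matrix.mul_assoc b, hbb]
    simp only [Matrix.mul_assoc]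
  rw [fidelity, ← ha, ← hb, traceNorm_eq_of_conjTranspose_mul, h1,
    trace_sqrt_mul_conjTranspose_comm, h2, traceNorm]

/-- The contraction part `U` of a polar decomposition, for which the trace norm is attained as
`‖Z‖₁ = Tr (Z U)`. -/
lemma exists_contraction_trace_mul (Z : Op N) :
    ∃ U : Op N, (1 - Uᴴ * U).PosSemidef ∧ (Z * U).trace.re = traceNorm Z := by
  have hM := posSemidef_self_mul_conjTranspose Z
  have hc : ∀ f : ℝ → ℝ, ContinuousOn f (spectrum ℝ (Z * Zᴴ)) :=
    fun f => (finite_real_spectrum).continuousOn f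
  have hsa : IsSelfAdjoint (Z * Zᴴ) := hM.1
  have hid : cfc (fun x : ℝ => x) (Z * Zᴴ) = Z * Zᴴ := cfc_id' ℝ _
  -- since `0⁻¹ = 0`, this is the pseudo-inverse of `√(Z Z†)`
  set G := cfc (fun x : ℝ => (Real.sqrt x)⁻¹) (Z * Zᴴ) with hG
  have hGH : Gᴴ = G := (cfc_predicate (p := IsSelfAdjoint) _ _ : IsSelfAdjoint G)
  have h1 : Z * Zᴴ * G = cfc (fun x : ℝ => x * (Real.sqrt x)⁻¹) (Z * Zᴴ) := by
    conv_lhs => rw [← hid]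
    rw [hG, hid]
    rw [cfc_mul (fun x : ℝ => x) _ _ (hc _) (hc _), hid]
  refine ⟨Zᴴ * G, ?_, ?_⟩
  · have h2 : 1 - (Zᴴ * G)ᴴ * (Zᴴ * G) =
        cfc (fun x : ℝ => 1 - (Real.sqrt x)⁻¹ * (x * (Real.sqrt x)⁻¹)) (Z * Zᴴ) := by
      rw [cfc_sub _ _ _ (hc _) (hc _), cfc_mul _ _ _ (hc _) (hc _), ← h1, ← hG,
        cfc_const_one ℝ (Z * Zᴴ), conjTranspose_mul, hGH, conjTranspose_conjTranspose]
      simp only [Matrix.mul_assoc]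
    rw [h2, ← nonneg_iff_posSemidef]
    refine cfc_nonneg fun x hx => ?_
    have hx0 : 0 ≤ x := spectrum_nonneg_of_nonneg hM.nonneg hx
    rcases hx0.eq_or_lt with rfl | hx0
    · simp
    · have := Real.sqrt_pos.2 hx0
      have h3 : (Real.sqrt x)⁻¹ * (x * (Real.sqrt x)⁻¹) = 1 := by
        field_simp
        rw [Real.sq_sqrt hx0.le]
      rw [h3]; simp
  · rw [traceNorm, ← Matrix.mul_assoc, h1, sqrt_eq_real_cfc hM]
    simp only [← div_eq_mul_inv, Real.div_sqrt]

/-- One half of the Fuchs–Caves inequality, for a single effect `S² ≥ 0`. -/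
lemma re_trace_contraction_mul_le {a b U S : Op N} (ha : aᴴ = a) (hb : bᴴ = b) (hS : Sᴴ = S)
    (hU : (1 - Uᴴ * U).PosSemidef) :
    (U * a * (S * S) * b).trace.re ≤
      √((S * S * (a * a)).trace.re) * √((S * S * (b * b)).trace.re) := by
  have h1 := re_trace_conjTranspose_mul_le ((U * a * S)ᴴ) (S * b)
  rw [conjTranspose_conjTranspose] at h1
  have h2 : (U * a * S * (U * a * S)ᴴ).trace.re ≤ (S * S * (a * a)).trace.re := by
    have h3 := (hU.conjTranspose_mul_mul_same (a * S)).trace_nonneg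
    have h4 : (U * a * S * (U * a * S)ᴴ).trace = ((a * S)ᴴ * (Uᴴ * U) * (a * S)).trace := by
      rw [trace_mul_comm]
      simp only [conjTranspose_mul, Matrix.mul_assoc]
    have h5 : (S * S * (a * a)).trace = ((a * S)ᴴ * (a * S)).trace := by
      rw [Matrix.mul_assoc, trace_mul_comm, conjTranspose_mul, ha, hS, trace_mul_comm (S * a)]
      simp only [Matrix.mul_assoc]
      rw [trace_mul_comm]
      simp only [Matrix.mul_assoc]
      rw [trace_mul_comm]
      simp only [Matrix.mul_assoc]
    have h6 := (Complex.le_def.1 h3).1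
    rw [Matrix.mul_sub, Matrix.sub_mul, Matrix.mul_one, trace_sub, Complex.sub_re, ← h4,
      ← h5] at h6
    simpa using h6
  have h7 : (S * S * (b * b)).trace = ((S * b)ᴴ * (S * b)).trace := by
    rw [← Matrix.mul_assoc, trace_mul_comm, conjTranspose_mul, hb, hS]
    simp only [Matrix.mul_assoc]
  calc _ = (U * a * S * (S * b)).trace.re := by simp only [Matrix.mul_assoc]
    _ ≤ _ := h1
    _ ≤ _ := by
      rw [← h7]
      gcongr

/-- The fidelity is at most the Bhattacharyya coefficient of the outcome distributions of any
two-outcome measurement `(T, 1 - T)`. -/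
lemma fidelity_le_bhattacharyya {ρ σ T : Op N} (hρ : ρ.PosSemidef) (hσ : σ.PosSemidef)
    (hT : T.PosSemidef) (hT' : (1 - T).PosSemidef) :
    fidelity ρ σ ≤ √((T * ρ).trace.re) * √((T * σ).trace.re) +
      √(((1 - T) * ρ).trace.re) * √(((1 - T) * σ).trace.re) := by
  obtain ⟨U, hU, hF⟩ := exists_contraction_trace_mul (CFC.sqrt ρ * CFC.sqrt σ)
  have hH : ∀ M : Op N, (CFC.sqrt M)ᴴ = CFC.sqrt M := fun M => (CFC.sqrt_nonneg M).posSemidef.1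
  have hsq : ∀ {M : Op N}, M.PosSemidef → CFC.sqrt M * CFC.sqrt M = M :=
    fun hM => CFC.sqrt_mul_sqrt_self _ hM.nonneg
  have h1 := re_trace_contraction_mul_le (hH ρ) (hH σ) (hH T) hU
  have h2 := re_trace_contraction_mul_le (hH ρ) (hH σ) (hH (1 - T)) hU
  rw [hsq hT, hsq hρ, hsq hσ] at h1
  rw [hsq hT', hsq hρ, hsq hσ] at h2
  have h3 : (CFC.sqrt ρ * CFC.sqrt σ * U).trace = (U * CFC.sqrt ρ * T * CFC.sqrt σ).trace +
      (U * CFC.sqrt ρ * (1 - T) * CFC.sqrt σ).trace := by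
    rw [← trace_add, ← Matrix.add_mul, ← Matrix.mul_add, add_sub_cancel, Matrix.mul_one,
      trace_mul_comm, Matrix.mul_assoc]
  rw [fidelity, ← hF, h3, Complex.add_re]
  exact add_le_add h1 h2

open scoped Matrix.Norms.L2Operator in
lemma continuousOn_sqrt : ContinuousOn (CFC.sqrt : Op N → Op N) {M | M.PosSemidef} := by
  simpa only [nonneg_iff_posSemidef] using CFC.continuousOn_sqrt (A := Op N)

lemma continuous_traceNorm : Continuous (traceNorm : Op N → ℝ) := by
  have h : Continuous fun L : Op N => CFC.sqrt (L * Lᴴ) :=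
    continuousOn_sqrt.comp_continuous (by fun_prop) posSemidef_self_mul_conjTranspose
  exact Complex.continuous_re.comp h.matrix_trace

lemma continuous_fidelity {X : Type*} [TopologicalSpace X] {f g : X → Op N} (hf : Continuous f)
    (hg : Continuous g) (hf' : ∀ x, (f x).PosSemidef) (hg' : ∀ x, (g x).PosSemidef) :
    Continuous fun x => fidelity (f x) (g x) :=
  continuous_traceNorm.comp ((continuousOn_sqrt.comp_continuous hf hf').mul
    (continuousOn_sqrt.comp_continuous hg hg'))

end TraceNorm

/-! ### Channels and effects -/

section Channels

variable {A B C R : Type*} [Fintype A] [Fintype B] [Fintype C] [Fintype R]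

/-- Complete positivity, stated for the ancillas `Fin k`, extends to every finite ancilla. -/
lemma IsChannel.posSemidef_tensorId {Φ : Op A →ₗ[ℂ] Op B} (hΦ : IsChannel Φ) {X : Op (A × R)}
    (hX : X.PosSemidef) : (tensorId R Φ X).PosSemidef := by
  have h := (hΦ.1 _ _ (hX.submatrix (Prod.map id (Fintype.equivFin R).symm))).submatrix
    (Prod.map id (Fintype.equivFin R))
  convert h using 1
  ext i j
  simp [tensorId, Prod.map]

lemma IsChannel.posSemidef {Φ : Op A →ₗ[ℂ] Op B} (hΦ : IsChannel Φ) {X : Op A}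
    (hX : X.PosSemidef) : (Φ X).PosSemidef :=
  (hΦ.posSemidef_tensorId (R := Unit) (hX.submatrix Prod.fst)).submatrix fun b => (b, ())

lemma IsChannel.isDensity {Φ : Op A →ₗ[ℂ] Op B} (hΦ : IsChannel Φ) {ρ : Op A}
    (hρ : IsDensity ρ) : IsDensity (Φ ρ) :=
  ⟨hΦ.posSemidef hρ.1, (hΦ.2 ρ).trans hρ.2⟩

lemma IsChannel.tensorId {Φ : Op A →ₗ[ℂ] Op B} (hΦ : IsChannel Φ) :
    IsChannel (tensorId R Φ) := by
  constructor
  · intro k X hX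
    exact (hΦ.posSemidef_tensorId (R := R × Fin k)
      (hX.submatrix (Equiv.prodAssoc A R (Fin k)).symm)).submatrix (Equiv.prodAssoc B R (Fin k))
  · intro X
    have h : ∀ r, ∑ b, QuantumDiscrimination.tensorId R Φ X (b, r) (b, r) =
        ∑ a, X (a, r) (a, r) := fun r =>
      hΦ.2 (Matrix.of fun a a' => X (a, r) (a', r))
    simp only [trace, diag_apply, Fintype.sum_prod_type_right, h]

lemma IsChannel.comp {Ψ : Op B →ₗ[ℂ] Op C} {Φ : Op A →ₗ[ℂ] Op B} (hΨ : IsChannel Ψ)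
    (hΦ : IsChannel Φ) : IsChannel (Ψ ∘ₗ Φ) :=
  ⟨fun k X hX => hΨ.1 k _ (hΦ.1 k X hX), fun X => (hΨ.2 _).trans (hΦ.2 X)⟩

/-- The map discarding its input and preparing `τ`. -/
def prepare (A : Type*) {B : Type*} [Fintype A] (τ : Op B) : Op A →ₗ[ℂ] Op B :=
  (traceLinearMap A ℂ ℂ).smulRight τ

lemma prepare_apply {B : Type*} (τ : Op B) (X : Op A) : prepare A τ X = X.trace • τ := rfl

lemma isChannel_prepare {τ : Op B} (hτ : IsDensity τ) : IsChannel (prepare A τ) := by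
  constructor
  · intro k X hX
    have h1 : (traceFst X).PosSemidef := by
      have : traceFst X = ∑ a, X.submatrix (fun i => (a, i)) fun i => (a, i) := by
        ext i j
        simp [traceFst, Matrix.sum_apply]
      rw [this]
      exact posSemidef_sum _ fun a _ => hX.submatrix _
    have h2 : tensorId (Fin k) (prepare A τ) X = kroneckerMap (· * ·) τ (traceFst X) := by
      ext i j
      simp [tensorId, prepare, traceFst, trace, mul_comm, kroneckerMap_apply]
    rw [h2]
    exact hτ.1.kronecker h1
  · intro X
    rw [prepare_apply, trace_smul, hτ.2, smul_eq_mul, mul_one]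

lemma posSemidef_of_trace_mul_ketBra {N : Type*} [Fintype N] [DecidableEq N] {T : Op N}
    (h : ∀ φ : N → ℂ, 0 ≤ (T * ketBra φ).trace) : T.PosSemidef := by
  rw [← isPositive_toEuclideanLin_iff, LinearMap.isPositive_iff_complex]
  intro x
  have h1 : inner ℂ (toEuclideanLin T x) x = star ((T * ketBra x.ofLp).trace) := by
    rw [ketBra, mul_vecMulVec, trace_vecMulVec, EuclideanSpace.inner_eq_star_dotProduct]
    rw [← star_dotProduct_star, star_star]
    rfl
  have h2 := Complex.le_def.1 (h x.ofLp)
  rw [h1]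
  refine ⟨?_, ?_⟩
  · apply Complex.ext
    · simp
    · simpa using h2.2.symm
  · simpa using h2.1

/-- A linear functional with values between `0` and the trace on positive operators is of the form
`Tr (T ·)` for an effect `T`. -/
lemma exists_effect {N : Type*} [Fintype N] [DecidableEq N] (f : Op N →ₗ[ℂ] ℂ)
    (hf : ∀ X : Op N, X.PosSemidef → 0 ≤ f X) (hf' : ∀ X : Op N, X.PosSemidef → f X ≤ X.trace) :
    ∃ T : Op N, T.PosSemidef ∧ (1 - T).PosSemidef ∧ ∀ X, f X = (T * X).trace := by
  have key : ∀ X, f X = ((Matrix.of fun i j => f (single j i 1)) * X).trace := fun X => by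
    conv_lhs => rw [matrix_eq_sum_single X]
    simp only [map_sum, trace, diag_apply, mul_apply, of_apply]
    rw [Finset.sum_comm]
    refine Finset.sum_congr rfl fun i _ => Finset.sum_congr rfl fun j _ => ?_
    rw [← mul_one (X j i), ← smul_eq_mul, ← smul_single, map_smul, smul_eq_mul, smul_eq_mul,
      mul_one, mul_comm]
  refine ⟨_, ?_, ?_, key⟩
  · exact posSemidef_of_trace_mul_ketBra fun φ =>
      key (ketBra φ) ▸ hf _ (posSemidef_vecMulVec_self_star φ)
  · refine posSemidef_of_trace_mul_ketBra fun φ => ?_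
    rw [Matrix.sub_mul, trace_sub, ← key, Matrix.one_mul, sub_nonneg]
    exact hf' _ (posSemidef_vecMulVec_self_star φ)

/-- The trace of a product of positive operators is nonnegative. -/
lemma trace_mul_nonneg {N : Type*} [Fintype N] [DecidableEq N] {S T : Op N} (hS : S.PosSemidef)
    (hT : T.PosSemidef) : 0 ≤ (S * T).trace := by
  have hH : (CFC.sqrt S)ᴴ = CFC.sqrt S := (CFC.sqrt_nonneg S).posSemidef.1
  have hsq : CFC.sqrt S * CFC.sqrt S = S := CFC.sqrt_mul_sqrt_self _ hS.nonneg
  have h := (hT.conjTranspose_mul_mul_same (CFC.sqrt S)).trace_nonneg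
  rwa [hH, trace_mul_comm, ← Matrix.mul_assoc, hsq] at h

/-- A density operator is a convex combination of pure states. -/
lemma IsDensity.exists_convex_ketBra {N : Type*} [Fintype N] [DecidableEq N] {ρ : Op N}
    (hρ : IsDensity ρ) : ∃ (w : N → ℝ) (v : N → N → ℂ), (∀ j, 0 ≤ w j) ∧ ∑ j, w j = 1 ∧
      (∀ j, IsStateVector (v j)) ∧ ρ = ∑ j, (w j : ℂ) • ketBra (v j) := by
  have hH := hρ.1.1
  refine ⟨hH.eigenvalues, fun j => hH.eigenvectorBasis j, hρ.1.eigenvalues_nonneg, ?_, ?_, ?_⟩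
  · have h := hH.trace_eq_sum_eigenvalues
    rw [hρ.2] at h
    rw [← RCLike.ofReal_sum] at h
    exact Complex.ofReal_eq_one.1 h.symm
  · intro j
    have h := hH.eigenvectorBasis.orthonormal.1 j
    have h2 := inner_self_eq_norm_sq_to_K (𝕜 := ℂ) (hH.eigenvectorBasis j)
    rw [h, EuclideanSpace.inner_eq_star_dotProduct, dotProduct_comm] at h2
    simpa [IsStateVector] using h2
  · ext i k
    conv_lhs => rw [hH.spectral_theorem, Unitary.conjStarAlgAut_apply]
    simp [mul_apply, diagonal_apply, Matrix.sum_apply, ketBra, vecMulVec_apply, star_apply,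
      IsHermitian.eigenvectorUnitary_apply]
    exact Finset.sum_congr rfl fun _ _ => by ring

end Channels

/-! ### Compactness of the sets of channels, measurements and states -/

section Compactness

variable {N M : Type*} [Fintype N] [Fintype M]

open scoped Matrix.Norms.L2Operator in
lemma isClosed_posSemidef [DecidableEq N] : IsClosed {X : Op N | X.PosSemidef} := by
  simpa only [nonneg_iff_posSemidef] using CStarAlgebra.isClosed_nonneg (A := Op N)

/-- The entries of a positive operator are bounded by its trace. -/
lemma norm_apply_le_trace {X : Op N} (hX : X.PosSemidef) (i j : N) : ‖X i j‖ ≤ X.trace.re := by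
  have hd : ∀ k, 0 ≤ (X k k).re := fun k => (Complex.le_def.1 hX.diag_nonneg).1
  have hle : ∀ k, (X k k).re ≤ X.trace.re := fun k => by
    rw [trace, Complex.re_sum]
    exact Finset.single_le_sum (f := fun k => (X k k).re) (fun k _ => hd k) (Finset.mem_univ k)
  have him : ∀ k, (X k k).im = 0 := fun k => (Complex.le_def.1 hX.diag_nonneg).2.symm
  -- the principal minor on the rows `i` and `j` is nonnegative
  have h := (Complex.le_def.1 (hX.submatrix ![i, j]).det_nonneg).1
  have hji : X j i = star (X i j) := (hX.1.apply j i).symm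
  simp only [det_fin_two, submatrix_apply, cons_val_zero, cons_val_one, hji, Complex.star_def,
    Complex.mul_conj, Complex.sub_re, Complex.mul_re, him, Complex.ofReal_re,
    Complex.normSq_eq_norm_sq, Complex.zero_re, mul_zero, sub_zero] at h
  have := mul_le_mul (hle i) (hle j) (hd j) ((hd i).trans (hle i))
  nlinarith [norm_nonneg (X i j), hd i, hle i]

/-- The linear map sending the matrix unit `E i j` to the block `c i j`. -/
def ofBlocks {M : Type*} (c : N → N → Op M) : Op N →ₗ[ℂ] Op M :=
  ∑ i, ∑ j, (entryLinearMap ℂ ℂ i j).smulRight (c i j)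

lemma ofBlocks_apply {M : Type*} (c : N → N → Op M) (X : Op N) :
    ofBlocks c X = ∑ i, ∑ j, X i j • c i j := by
  simp [ofBlocks, LinearMap.sum_apply]

lemma ofBlocks_single [DecidableEq N] {M : Type*} (Φ : Op N →ₗ[ℂ] Op M) :
    ofBlocks (fun i j => Φ (single i j 1)) = Φ := by
  ext1 X
  conv_rhs => rw [matrix_eq_sum_single X]
  rw [ofBlocks_apply]
  simp only [map_sum]
  refine Finset.sum_congr rfl fun i _ => Finset.sum_congr rfl fun j _ => ?_
  rw [← map_smul, smul_single, smul_eq_mul, mul_one]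

lemma ofBlocks_apply_single [DecidableEq N] {M : Type*} (c : N → N → Op M) (i j : N) :
    ofBlocks c (single i j 1) = c i j := by
  simp [ofBlocks_apply, single_apply, ite_and]

lemma continuous_ofBlocks_apply {M Y : Type*} [TopologicalSpace Y] {c : Y → N → N → Op M}
    {X : Y → Op N} (hc : Continuous c) (hX : Continuous X) :
    Continuous fun y => ofBlocks (c y) (X y) := by
  simp only [ofBlocks_apply]
  fun_prop

/-- The blocks of a channel form its Choi operator, which is positive with trace `dim N`. -/
lemma IsChannel.norm_apply_single_le [DecidableEq N] {Φ : Op N →ₗ[ℂ] Op M}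
    (hΦ : IsChannel Φ) (i j : N) (x y : M) : ‖Φ (single i j 1) x y‖ ≤ Fintype.card N := by
  set v : N × N → ℂ := fun q => if q.1 = q.2 then 1 else 0 with hv
  have h := norm_apply_le_trace
    (hΦ.posSemidef_tensorId (R := N) (posSemidef_vecMulVec_self_star v)) (x, i) (y, j)
  have h1 : ∀ k l, (Matrix.of fun a a' : N => vecMulVec v (star v) (a, k) (a', l)) =
      single k l 1 := fun k l => by
    ext a a'
    simp only [of_apply, vecMulVec_apply, hv, single_apply, Pi.star_apply,
      eq_comm (a := k), eq_comm (a := l)]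
    by_cases h : a = k <;> simp [h]
  rw [hΦ.tensorId.2] at h
  have h2 : (vecMulVec v (star v)).trace.re = Fintype.card N := by
    simp [trace, vecMulVec_apply, hv, Fintype.sum_prod_type]
  rw [h2] at h
  refine le_trans (le_of_eq ?_) h
  rw [← h1]
  rfl

lemma isCompact_channelBlocks [DecidableEq N] [DecidableEq M] :
    IsCompact {c : N → N → Op M | IsChannel (ofBlocks c)} := by
  have hbox : IsCompact (Set.univ.pi fun _ : N => Set.univ.pi fun _ : N =>
      Set.univ.pi fun _ : M => Set.univ.pi fun _ : M =>
        Metric.closedBall (0 : ℂ) (Fintype.card N)) :=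
    isCompact_univ_pi fun _ => isCompact_univ_pi fun _ => isCompact_univ_pi fun _ =>
      isCompact_univ_pi fun _ => isCompact_closedBall _ _
  refine hbox.of_isClosed_subset ?_ ?_
  · have h : {c : N → N → Op M | IsChannel (ofBlocks c)} =
        (⋂ (k : ℕ) (X : Op (N × Fin k)) (_ : X.PosSemidef),
          (fun c => tensorId (Fin k) (ofBlocks c) X) ⁻¹' {Y | Y.PosSemidef}) ∩
        ⋂ X : Op N, {c | (ofBlocks c X).trace = X.trace} := by
      ext c
      simp [IsChannel]
    rw [h]
    refine IsClosed.inter (isClosed_iInter fun k => isClosed_iInter fun X => isClosed_iInter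
      fun _ => isClosed_posSemidef.preimage ?_) (isClosed_iInter fun X => isClosed_eq ?_
        continuous_const)
    · refine continuous_matrix fun i j => ?_
      exact (continuous_ofBlocks_apply continuous_id continuous_const).matrix_elem i.1 j.1
    · exact (continuous_ofBlocks_apply continuous_id continuous_const).matrix_trace
  · intro (c : N → N → Op M) (hc : IsChannel (ofBlocks c)) i _ j _ x _ y _
    have h := IsChannel.norm_apply_single_le hc i j x y
    rw [ofBlocks_apply_single] at h
    simpa using h

lemma isCompact_povm [DecidableEq N] {H : Type*} [Fintype H] :
    IsCompact {T : H → Op N | IsPOVM T} := by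
  have hbox : IsCompact (Set.univ.pi fun _ : H => Set.univ.pi fun _ : N => Set.univ.pi fun _ : N =>
      Metric.closedBall (0 : ℂ) (Fintype.card N)) :=
    isCompact_univ_pi fun _ => isCompact_univ_pi fun _ => isCompact_univ_pi fun _ =>
      isCompact_closedBall _ _
  refine hbox.of_isClosed_subset ?_ ?_
  · have h : {T : H → Op N | IsPOVM T} =
        (⋂ η, (fun T : H → Op N => T η) ⁻¹' {Y | Y.PosSemidef}) ∩ {T | ∑ η, T η = 1} := by
      ext T
      simp [IsPOVM]
    rw [h]
    exact (isClosed_iInter fun η => isClosed_posSemidef.preimage (by fun_prop)).inter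
      (isClosed_eq (by fun_prop) continuous_const)
  · intro (T : H → Op N) (hT : IsPOVM T) η _ i _ j _
    have h1 : ∑ η, (T η).trace.re = Fintype.card N := by
      rw [← Complex.re_sum, ← trace_sum, hT.2]
      simp
    have h2 : (T η).trace.re ≤ ∑ η, (T η).trace.re :=
      Finset.single_le_sum (f := fun η => (T η).trace.re)
        (fun η _ => (Complex.le_def.1 (hT.1 η).trace_nonneg).1) (Finset.mem_univ η)
    simpa using (norm_apply_le_trace (hT.1 η) i j).trans (h2.trans_eq h1)

lemma isCompact_stateVectors : IsCompact {φ : N → ℂ | IsStateVector φ} := by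
  have hbox : IsCompact (Set.univ.pi fun _ : N => Metric.closedBall (0 : ℂ) 1) :=
    isCompact_univ_pi fun _ => isCompact_closedBall _ _
  refine hbox.of_isClosed_subset (isClosed_eq (by fun_prop) continuous_const) ?_
  intro φ hφ i _
  have h := norm_apply_le_trace (posSemidef_vecMulVec_self_star φ) i i
  rw [trace_vecMulVec, dotProduct_comm, show star φ ⬝ᵥ φ = 1 from hφ, vecMulVec_apply] at h
  have h2 : ‖φ i‖ * ‖φ i‖ ≤ 1 := by simpa using h
  have h3 : ‖φ i‖ ≤ 1 := by nlinarith [norm_nonneg (φ i)]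
  simpa using h3

end Compactness

/-! ### The evolution of an algorithm -/

section Evolution

variable {A B R : Type*} [DecidableEq B] [DecidableEq R]

/-- The linear evolution of the initial state under `n` rounds of an algorithm. -/
def evolution (oracle : Op A →ₗ[ℂ] Op B) :
    (n : ℕ) → (Fin n → Op (B × R) →ₗ[ℂ] Op (A × R)) → Op (B × R) →ₗ[ℂ] Op (B × R)
  | 0, _ => LinearMap.id
  | n + 1, Φ => tensorId R oracle ∘ₗ Φ (Fin.last n) ∘ₗ evolution oracle n fun k => Φ k.castSucc

lemma finalState_eq_evolution (oracle : Op A →ₗ[ℂ] Op B) (z : B × R) (n : ℕ)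
    (Φ : Fin n → Op (B × R) →ₗ[ℂ] Op (A × R)) :
    finalState oracle z n Φ = evolution oracle n Φ (single z z 1) := by
  induction n with
  | zero => rfl
  | succ n ih => rw [finalState, ih]; rfl

omit [DecidableEq B] [DecidableEq R] in
/-- The evolution splits off its first round. -/
lemma evolution_succ_left (oracle : Op A →ₗ[ℂ] Op B) (n : ℕ)
    (Φ : Fin (n + 1) → Op (B × R) →ₗ[ℂ] Op (A × R)) :
    evolution oracle (n + 1) Φ =
      evolution oracle n (fun k => Φ k.succ) ∘ₗ tensorId R oracle ∘ₗ Φ 0 := by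
  induction n with
  | zero => rfl
  | succ n ih => rw [evolution, ih]; rfl

omit [DecidableEq B] [DecidableEq R] in
lemma isChannel_evolution [Fintype A] [Fintype B] [Fintype R] {oracle : Op A →ₗ[ℂ] Op B}
    (hO : IsChannel oracle) {n : ℕ} {Φ : Fin n → Op (B × R) →ₗ[ℂ] Op (A × R)}
    (hΦ : ∀ k, IsChannel (Φ k)) : IsChannel (evolution oracle n Φ) := by
  induction n with
  | zero => exact ⟨fun k X hX => hX, fun X => rfl⟩
  | succ n ih => exact hO.tensorId.comp ((hΦ _).comp (ih fun k => hΦ _))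

lemma isDensity_single {N : Type*} [Fintype N] [DecidableEq N] (x : N) :
    IsDensity (single x x (1 : ℂ)) := by
  refine ⟨?_, trace_single_eq_same _ _⟩
  have h := posSemidef_vecMulVec_self_star (Pi.single x 1 : N → ℂ)
  rwa [show star (Pi.single x 1 : N → ℂ) = Pi.single x 1 by simp,
    ← single_eq_single_vecMulVec_single] at h

end Evolution

namespace QCGDP

variable {Ξ H A B R : Type*} [Fintype Ξ] [DecidableEq Ξ] [Fintype H] [Fintype A] [Fintype B]
  [Fintype R] [DecidableEq A] [DecidableEq B] [DecidableEq R]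

/-! ### Existence of the minima -/

theorem isLeast_pErr [Nonempty H] [Nonempty A] (Q : QCGDP Ξ H A B) (z : B × R) (n : ℕ) :
    IsLeast (Q.errorProbs z n) (Q.pErr z n) := by
  set D : Set ((Fin n → B × R → B × R → Op (A × R)) × (H → Op (B × R))) :=
    (Set.univ.pi fun _ => {c | IsChannel (ofBlocks c)}) ×ˢ {M | IsPOVM M} with hD
  have himage : Q.errorProbs z n =
      (fun d => Q.errorProb z (fun k => ofBlocks (d.1 k)) d.2) '' D := by
    ext e
    constructor
    · rintro ⟨Φ, M, hΦ, hM, rfl⟩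
      refine ⟨(fun k i j => Φ k (single i j 1), M), ⟨fun k _ => ?_, hM⟩, ?_⟩
      · simpa only [Set.mem_ofPred_eq, ofBlocks_single] using hΦ k
      · simp only [ofBlocks_single]
    · rintro ⟨⟨c, M⟩, ⟨hc, hM⟩, rfl⟩
      exact ⟨_, M, fun k => hc k trivial, hM, rfl⟩
  have hcompact : IsCompact D :=
    (isCompact_univ_pi fun _ => isCompact_channelBlocks).prod isCompact_povm
  have hne : (Q.errorProbs z n).Nonempty := by
    obtain ⟨a⟩ := ‹Nonempty A›
    obtain ⟨η⟩ := ‹Nonempty H›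
    classical
    refine ⟨_, fun _ => prepare _ (single (a, z.2) (a, z.2) 1), Pi.single η 1, fun _ =>
      isChannel_prepare (isDensity_single _), ⟨fun η' => ?_, by simp⟩, rfl⟩
    by_cases h : η' = η
    · subst h; simpa using PosSemidef.one
    · simpa [h] using PosSemidef.zero
  have hstate : ∀ (oracle : Op A →ₗ[ℂ] Op B) (n : ℕ),
      Continuous fun c : Fin n → B × R → B × R → Op (A × R) =>
        finalState oracle z n fun k => ofBlocks (c k) := fun oracle n => by
    induction n with
    | zero => exact continuous_const
    | succ n ih =>
      refine (tensorId R oracle).continuous_of_finiteDimensional.comp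
        (continuous_ofBlocks_apply (continuous_apply _) (ih.comp (by fun_prop)))
  have hcont : Continuous fun d : (Fin n → B × R → B × R → Op (A × R)) × (H → Op (B × R)) =>
      Q.errorProb z (fun k => ofBlocks (d.1 k)) d.2 := by
    refine continuous_finsetSum _ fun ξ _ => continuous_const.mul
      (continuous_finsetSum _ fun η _ => Complex.continuous_re.comp (Continuous.matrix_trace ?_))
    exact Continuous.matrix_mul ((continuous_apply η).comp continuous_snd)
      ((hstate (Q.O ξ) n).comp continuous_fst)
  rw [pErr]
  refine IsCompact.isLeast_sInf ?_ hne
  rw [himage]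
  exact hcompact.image hcont

omit [DecidableEq Ξ] [Fintype H] in
theorem isLeast_avgFidelities [Nonempty A] [Nonempty R] (Q : QCGDP Ξ H A B)
    {Ψ : Op (A × R) →ₗ[ℂ] Op (B × R)} (hΨ : IsChannel Ψ) :
    IsLeast (Q.avgFidelities Ψ) (sInf (Q.avgFidelities Ψ)) := by
  have himage : Q.avgFidelities Ψ = (fun φ : A × R → ℂ => ∑ ξ, Q.p ξ *
      fidelity (tensorId R (Q.O ξ) (ketBra φ)) (Ψ (ketBra φ))) '' {φ | IsStateVector φ} := by
    ext f
    exact ⟨fun ⟨φ, h, h'⟩ => ⟨φ, h, h'.symm⟩, fun ⟨φ, h, h'⟩ => ⟨φ, h, h'.symm⟩⟩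
  rw [himage]
  have hket : Continuous (ketBra : (A × R → ℂ) → Op (A × R)) := by
    unfold ketBra
    fun_prop
  refine IsCompact.isLeast_sInf (isCompact_stateVectors.image ?_) (Set.Nonempty.image _ ?_)
  · refine continuous_finsetSum _ fun ξ _ => continuous_const.mul (continuous_fidelity
      ((tensorId R (Q.O ξ)).continuous_of_finiteDimensional.comp hket)
      (Ψ.continuous_of_finiteDimensional.comp hket) (fun φ => ?_) fun φ => ?_)
    · exact (Q.O_channel ξ).posSemidef_tensorId (posSemidef_vecMulVec_self_star φ)
    · exact hΨ.posSemidef (posSemidef_vecMulVec_self_star φ)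
  · obtain ⟨x⟩ : Nonempty (A × R) := inferInstance
    exact ⟨Pi.single x 1, by simp [IsStateVector]⟩

end QCGDP

/-! ### Replacing one query -/

/-- Concavity of the Bhattacharyya coefficient of two-point distributions. -/
lemma sum_bhattacharyya_le {ι : Type*} [Fintype ι] {P x y : ι → ℝ} (hP : ∀ i, 0 ≤ P i)
    (hP1 : ∑ i, P i = 1) (hx : ∀ i, x i ∈ Set.Icc (0 : ℝ) 1) (hy : ∀ i, y i ∈ Set.Icc (0 : ℝ) 1) :
    ∑ i, P i * (√(x i) * √(y i) + √(1 - x i) * √(1 - y i)) ≤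
      √(∑ i, P i * x i) * √(∑ i, P i * y i) +
        √(1 - ∑ i, P i * x i) * √(1 - ∑ i, P i * y i) := by
  have key : ∀ u v : ι → ℝ, (∀ i, 0 ≤ u i) → (∀ i, 0 ≤ v i) →
      ∑ i, P i * (√(u i) * √(v i)) ≤ √(∑ i, P i * u i) * √(∑ i, P i * v i) := fun u v hu hv => by
    have h := Real.sum_sqrt_mul_sqrt_le Finset.univ (f := fun i => P i * u i)
      (g := fun i => P i * v i) (fun i => mul_nonneg (hP i) (hu i))
      (fun i => mul_nonneg (hP i) (hv i))
    refine le_trans (le_of_eq (Finset.sum_congr rfl fun i _ => ?_)) h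
    rw [Real.sqrt_mul (hP i), Real.sqrt_mul (hP i), mul_mul_mul_comm,
      Real.mul_self_sqrt (hP i)]
  have hc : ∀ u : ι → ℝ, 1 - ∑ i, P i * u i = ∑ i, P i * (1 - u i) := fun u => by
    simp only [mul_sub, mul_one, Finset.sum_sub_distrib, hP1]
  simp only [mul_add, Finset.sum_add_distrib]
  rw [hc, hc]
  exact add_le_add (key x y (fun i => (hx i).1) fun i => (hy i).1)
    (key _ _ (fun i => sub_nonneg.2 (hx i).2) fun i => sub_nonneg.2 (hy i).2)

/-- The triangle inequality for the angles `arccos √e` of two-point distributions `(e, 1 - e)`: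
the right-hand side of `h` is the cosine of the difference of the angles. -/
lemma arccos_sqrt_le_add {e e' c : ℝ} (he : e ∈ Set.Icc (0 : ℝ) 1) (he' : e' ∈ Set.Icc (0 : ℝ) 1)
    (h : c ≤ √e * √e' + √(1 - e) * √(1 - e')) :
    Real.arccos √e ≤ Real.arccos c + Real.arccos √e' := by
  rcases le_total (Real.arccos √e) (Real.arccos √e') with hle | hle
  · linarith [Real.arccos_nonneg c]
  · have hcos : Real.cos (Real.arccos √e - Real.arccos √e') =
        √e * √e' + √(1 - e) * √(1 - e') := by
      have h1 : √e ≤ 1 := Real.sqrt_le_one.2 he.2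
      have h1' : √e' ≤ 1 := Real.sqrt_le_one.2 he'.2
      rw [Real.cos_sub, Real.cos_arccos (by linarith [Real.sqrt_nonneg e]) h1,
        Real.cos_arccos (by linarith [Real.sqrt_nonneg e']) h1', Real.sin_arccos,
        Real.sin_arccos, Real.sq_sqrt he.1, Real.sq_sqrt he'.1]
    have h2 := Real.arccos_le_arccos (h.trans_eq hcos.symm)
    rw [Real.arccos_cos (sub_nonneg.2 hle)
      (by linarith [Real.arccos_le_pi √e, Real.arccos_nonneg √e'])] at h2
    linarith

lemma sum_weights_mem_Icc {ι : Type*} [Fintype ι] {P x : ι → ℝ} (hP : ∀ i, 0 ≤ P i)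
    (hP1 : ∑ i, P i = 1) (hx : ∀ i, x i ∈ Set.Icc (0 : ℝ) 1) :
    ∑ i, P i * x i ∈ Set.Icc (0 : ℝ) 1 :=
  ⟨Finset.sum_nonneg fun i _ => mul_nonneg (hP i) (hx i).1,
    hP1 ▸ Finset.sum_le_sum fun i _ => mul_le_of_le_one_right (hP i) (hx i).2⟩

/-- An effect assigns a probability to every density operator. -/
lemma re_trace_effect_mem_Icc {N : Type*} [Fintype N] [DecidableEq N] {T ρ : Op N}
    (hT : T.PosSemidef) (hT' : (1 - T).PosSemidef) (hρ : IsDensity ρ) :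
    (T * ρ).trace.re ∈ Set.Icc (0 : ℝ) 1 := by
  refine ⟨(Complex.le_def.1 (trace_mul_nonneg hT hρ.1)).1, ?_⟩
  have h := (Complex.le_def.1 (trace_mul_nonneg hT' hρ.1)).1
  rw [Matrix.sub_mul, Matrix.one_mul, trace_sub, hρ.2] at h
  simpa using h

lemma isDensity_ketBra {N : Type*} [Fintype N] {φ : N → ℂ} (hφ : IsStateVector φ) :
    IsDensity (ketBra φ) :=
  ⟨posSemidef_vecMulVec_self_star φ, by rw [ketBra, trace_vecMulVec, dotProduct_comm]; exact hφ⟩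

namespace QCGDP

variable {Ξ H A B R : Type*} [Fintype Ξ] [DecidableEq Ξ] [Fintype H] [Fintype A] [Fintype B]
  [Fintype R] [DecidableEq A] [DecidableEq B] [DecidableEq R]

/-- The effect that the measurement `M` returns an answer that is wrong for the oracle `ξ`. -/
def wrong {N : Type*} (Q : QCGDP Ξ H A B) (M : H → Op N) (ξ : Ξ) : Op N :=
  ∑ η with ξ ∉ Q.C η, M η

omit [DecidableEq A] in
lemma errorProb_eq (Q : QCGDP Ξ H A B) (z : B × R) {n : ℕ}
    (Φ : Fin n → Op (B × R) →ₗ[ℂ] Op (A × R)) (M : H → Op (B × R)) :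
    Q.errorProb z Φ M =
      ∑ ξ, Q.p ξ * (Q.wrong M ξ * evolution (Q.O ξ) n Φ (single z z 1)).trace.re := by
  refine Finset.sum_congr rfl fun ξ _ => ?_
  rw [wrong, Finset.sum_mul, trace_sum, Complex.re_sum, finalState_eq_evolution]

omit [DecidableEq A] [DecidableEq B] in
lemma posSemidef_wrong {N : Type*} [Fintype N] [DecidableEq N] (Q : QCGDP Ξ H A B)
    {M : H → Op N} (hM : IsPOVM M) (ξ : Ξ) :
    (Q.wrong M ξ).PosSemidef ∧ (1 - Q.wrong M ξ).PosSemidef := by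
  refine ⟨posSemidef_sum _ fun η _ => hM.1 η, ?_⟩
  rw [← hM.2, wrong, ← Finset.sum_filter_add_sum_filter_not Finset.univ fun η => ξ ∉ Q.C η,
    add_sub_cancel_left]
  exact posSemidef_sum _ fun η _ => hM.1 η

omit [DecidableEq A] in
lemma errorProb_mem_Icc (Q : QCGDP Ξ H A B) (z : B × R) {n : ℕ}
    {Φ : Fin n → Op (B × R) →ₗ[ℂ] Op (A × R)} {M : H → Op (B × R)} (hΦ : ∀ k, IsChannel (Φ k))
    (hM : IsPOVM M) : Q.errorProb z Φ M ∈ Set.Icc (0 : ℝ) 1 := by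
  rw [errorProb_eq]
  exact sum_weights_mem_Icc Q.p_nonneg Q.p_sum fun ξ =>
    re_trace_effect_mem_Icc (Q.posSemidef_wrong hM ξ).1 (Q.posSemidef_wrong hM ξ).2
      ((isChannel_evolution (Q.O_channel ξ) hΦ).isDensity (isDensity_single z))

omit [DecidableEq A] in
lemma pErr_le (Q : QCGDP Ξ H A B) (z : B × R) {n : ℕ}
    {Φ : Fin n → Op (B × R) →ₗ[ℂ] Op (A × R)} {M : H → Op (B × R)} (hΦ : ∀ k, IsChannel (Φ k))
    (hM : IsPOVM M) : Q.pErr z n ≤ Q.errorProb z Φ M := by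
  refine csInf_le ⟨0, ?_⟩ ⟨Φ, M, hΦ, hM, rfl⟩
  rintro _ ⟨Φ, M, hΦ, hM, rfl⟩
  exact (Q.errorProb_mem_Icc z hΦ hM).1

omit [DecidableEq A] in
/-- Starting from another density operator `τ` instead of the basis state `z` does not help: `τ` can
be prepared by the first channel of the algorithm, or, if there are no queries, its outcome
probabilities can be simulated by a measurement that ignores the state. -/
lemma pErr_le_of_initial (Q : QCGDP Ξ H A B) (z : B × R) {n : ℕ}
    {Φ : Fin n → Op (B × R) →ₗ[ℂ] Op (A × R)} {M : H → Op (B × R)} (hΦ : ∀ k, IsChannel (Φ k))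
    (hM : IsPOVM M) {τ : Op (B × R)} (hτ : IsDensity τ) :
    Q.pErr z n ≤ ∑ ξ, Q.p ξ * (Q.wrong M ξ * evolution (Q.O ξ) n Φ τ).trace.re := by
  cases n with
  | zero =>
    have hM' : IsPOVM fun η => (M η * τ).trace • (1 : Op (B × R)) := by
      refine ⟨fun η => PosSemidef.one.smul (trace_mul_nonneg (hM.1 η) hτ.1), ?_⟩
      rw [← Finset.sum_smul, ← trace_sum, ← Finset.sum_mul, hM.2, Matrix.one_mul, hτ.2, one_smul]
    refine (Q.pErr_le z (Φ := Φ) (fun k => k.elim0) hM').trans_eq ?_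
    rw [errorProb_eq]
    refine Finset.sum_congr rfl fun ξ _ => ?_
    rw [wrong, wrong, ← Finset.sum_smul, ← trace_sum, ← Finset.sum_mul]
    simp [evolution]
  | succ n =>
    have hΦ' : ∀ k, IsChannel (Fin.cons (α := fun _ => Op (B × R) →ₗ[ℂ] Op (A × R))
        (Φ 0 ∘ₗ prepare _ τ) (fun k => Φ k.succ) k) :=
      Fin.cases ((hΦ 0).comp (isChannel_prepare hτ)) fun k => hΦ k.succ
    refine (Q.pErr_le z hΦ' hM).trans_eq ?_
    rw [errorProb_eq]
    refine Finset.sum_congr rfl fun ξ _ => ?_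
    rw [evolution_succ_left, evolution_succ_left]
    simp [prepare_apply]

omit [DecidableEq A] [DecidableEq Ξ] [Fintype H] in
lemma bddBelow_avgFidelities (Q : QCGDP Ξ H A B)
    (Ψ : Op (A × R) →ₗ[ℂ] Op (B × R)) : BddBelow (Q.avgFidelities Ψ) := by
  refine ⟨0, ?_⟩
  rintro _ ⟨φ, -, rfl⟩
  exact Finset.sum_nonneg fun ξ _ => mul_nonneg (Q.p_nonneg ξ)
    (Complex.le_def.1 (CFC.sqrt_nonneg _).posSemidef.trace_nonneg).1

/-- Replacing the first query of an algorithm by `Ψ` changes its error probability from `e` to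
some `e' ≥ p_err(n)`, and the Bhattacharyya coefficient of the two distributions `(e, 1 - e)` and
`(e', 1 - e')` is at least the minimal averaged fidelity of the oracles and `Ψ`. -/
lemma exists_error_after_replacement (Q : QCGDP Ξ H A B) (z : B × R)
    {Ψ : Op (A × R) →ₗ[ℂ] Op (B × R)} (hΨ : IsChannel Ψ) {n : ℕ}
    {Φ : Fin (n + 1) → Op (B × R) →ₗ[ℂ] Op (A × R)} {M : H → Op (B × R)}
    (hΦ : ∀ k, IsChannel (Φ k)) (hM : IsPOVM M) :
    ∃ e' ∈ Set.Icc (0 : ℝ) 1, Q.pErr z n ≤ e' ∧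
      sInf (Q.avgFidelities Ψ) ≤ √(Q.errorProb z Φ M) * √e' +
        √(1 - Q.errorProb z Φ M) * √(1 - e') := by
  -- the effect of a wrong answer, pulled back through all rounds but the first
  have hT : ∀ ξ, ∃ T : Op (B × R), T.PosSemidef ∧ (1 - T).PosSemidef ∧
      ∀ X, (Q.wrong M ξ * evolution (Q.O ξ) n (fun k => Φ k.succ) X).trace = (T * X).trace := by
    intro ξ
    have hE : IsChannel (evolution (Q.O ξ) n fun k => Φ k.succ) :=
      isChannel_evolution (Q.O_channel ξ) fun k => hΦ _
    have hW := Q.posSemidef_wrong hM ξ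
    refine exists_effect (traceLinearMap _ ℂ ℂ ∘ₗ LinearMap.mulLeft ℂ (Q.wrong M ξ) ∘ₗ
      evolution (Q.O ξ) n fun k => Φ k.succ) (fun X hX => ?_) fun X hX => ?_
    · exact trace_mul_nonneg hW.1 (hE.posSemidef hX)
    · have h := trace_mul_nonneg hW.2 (hE.posSemidef hX)
      rw [Matrix.sub_mul, Matrix.one_mul, trace_sub, hE.2, sub_nonneg] at h
      exact h
  choose T hT0 hT1 hT using hT
  -- the state before the first query, which does not depend on the oracle
  obtain ⟨w, v, hw, hw1, hv, hσ⟩ := ((hΦ 0).isDensity (isDensity_single z)).exists_convex_ketBra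
  have hdecomp : ∀ (Θ : Op (A × R) →ₗ[ℂ] Op (B × R)) ξ,
      (T ξ * Θ (Φ 0 (single z z 1))).trace.re = ∑ j, w j * (T ξ * Θ (ketBra (v j))).trace.re := by
    intro Θ ξ
    rw [hσ]
    simp [Finset.mul_sum, trace_sum]
  set P : Ξ × (A × R) → ℝ := fun q => Q.p q.1 * w q.2 with hPdef
  have hP : ∀ q, 0 ≤ P q := fun q => mul_nonneg (Q.p_nonneg _) (hw _)
  have hP1 : ∑ q, P q = 1 := by
    simp [hPdef, Fintype.sum_prod_type, ← Finset.mul_sum, hw1, Q.p_sum]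
  have hsum : ∀ Θ : Ξ → Op (A × R) →ₗ[ℂ] Op (B × R),
      ∑ ξ, Q.p ξ * (T ξ * Θ ξ (Φ 0 (single z z 1))).trace.re =
        ∑ q, P q * (T q.1 * Θ q.1 (ketBra (v q.2))).trace.re := fun Θ => by
    simp only [hdecomp, Finset.mul_sum, Fintype.sum_prod_type, hPdef, mul_assoc]
  have hmem : ∀ Θ : Ξ → Op (A × R) →ₗ[ℂ] Op (B × R), (∀ ξ, IsChannel (Θ ξ)) →
      ∀ q : Ξ × (A × R), (T q.1 * Θ q.1 (ketBra (v q.2))).trace.re ∈ Set.Icc (0 : ℝ) 1 :=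
    fun Θ hΘ q => re_trace_effect_mem_Icc (hT0 _) (hT1 _)
      ((hΘ _).isDensity (isDensity_ketBra (hv _)))
  have he : Q.errorProb z Φ M =
      ∑ q, P q * (T q.1 * tensorId R (Q.O q.1) (ketBra (v q.2))).trace.re := by
    rw [← hsum fun ξ => tensorId R (Q.O ξ), errorProb_eq]
    simp only [evolution_succ_left, LinearMap.comp_apply, hT]
  have hO : ∀ ξ, IsChannel (tensorId R (Q.O ξ)) := fun ξ => (Q.O_channel ξ).tensorId
  have hx := hmem (fun ξ => tensorId R (Q.O ξ)) hO
  have hy := hmem (fun _ => Ψ) fun _ => hΨ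
  refine ⟨∑ q, P q * (T q.1 * Ψ (ketBra (v q.2))).trace.re,
    sum_weights_mem_Icc hP hP1 hy, ?_, ?_⟩
  · rw [← hsum fun _ => Ψ]
    simp only [← hT]
    exact Q.pErr_le_of_initial z (fun k => hΦ _) hM
      (hΨ.isDensity ((hΦ 0).isDensity (isDensity_single z)))
  · rw [he]
    refine le_trans ?_ (sum_bhattacharyya_le hP hP1 hx hy)
    have hF : ∀ q : Ξ × (A × R),
        fidelity (tensorId R (Q.O q.1) (ketBra (v q.2))) (Ψ (ketBra (v q.2))) ≤
          √((T q.1 * tensorId R (Q.O q.1) (ketBra (v q.2))).trace.re) *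
              √((T q.1 * Ψ (ketBra (v q.2))).trace.re) +
            √(1 - (T q.1 * tensorId R (Q.O q.1) (ketBra (v q.2))).trace.re) *
              √(1 - (T q.1 * Ψ (ketBra (v q.2))).trace.re) := fun q => by
      have hρ := (hO q.1).isDensity (isDensity_ketBra (hv q.2))
      have hσ := hΨ.isDensity (isDensity_ketBra (hv q.2))
      have h := fidelity_le_bhattacharyya hρ.1 hσ.1 (hT0 q.1) (hT1 q.1)
      simpa only [Matrix.sub_mul, Matrix.one_mul, trace_sub, hρ.2, hσ.2, Complex.sub_re,
        Complex.one_re] using h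
    calc sInf (Q.avgFidelities Ψ) = ∑ j, w j * sInf (Q.avgFidelities Ψ) := by
          rw [← Finset.sum_mul, hw1, one_mul]
      _ ≤ ∑ j, w j * ∑ ξ, Q.p ξ *
            fidelity (tensorId R (Q.O ξ) (ketBra (v j))) (Ψ (ketBra (v j))) :=
          Finset.sum_le_sum fun j _ => mul_le_mul_of_nonneg_left
            (csInf_le (Q.bddBelow_avgFidelities Ψ) ⟨v j, hv j, rfl⟩) (hw j)
      _ = ∑ q : Ξ × (A × R), P q *
            fidelity (tensorId R (Q.O q.1) (ketBra (v q.2))) (Ψ (ketBra (v q.2))) := by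
          refine Eq.trans (Finset.sum_congr rfl fun j _ => ?_)
            (Fintype.sum_prod_type_right _).symm
          rw [Finset.mul_sum]
          exact Finset.sum_congr rfl fun ξ _ => by simp only [hPdef]; ring
      _ ≤ _ := Finset.sum_le_sum fun q _ => mul_le_mul_of_nonneg_left (hF q) (hP q)

variable [Nonempty H] [Nonempty A]

lemma pErr_mem_Icc (Q : QCGDP Ξ H A B) (z : B × R) (n : ℕ) :
    Q.pErr z n ∈ Set.Icc (0 : ℝ) 1 := by
  obtain ⟨Φ, M, hΦ, hM, he⟩ := (Q.isLeast_pErr z n).1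
  exact he ▸ Q.errorProb_mem_Icc z hΦ hM

/-- One query decreases the angle of the error probability by at most `θ_𝒜(Ψ)`. -/
lemma theta_succ_le (Q : QCGDP Ξ H A B) (z : B × R) {Ψ : Op (A × R) →ₗ[ℂ] Op (B × R)}
    (hΨ : IsChannel Ψ) (n : ℕ) : Q.theta z (n + 1) ≤ Q.thetaA Ψ + Q.theta z n := by
  obtain ⟨Φ, M, hΦ, hM, he⟩ := (Q.isLeast_pErr z (n + 1)).1
  obtain ⟨e', he', hle, hF⟩ := Q.exists_error_after_replacement z hΨ hΦ hM
  rw [← he] at hF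
  exact (arccos_sqrt_le_add (Q.pErr_mem_Icc z _) he' hF).trans
    (add_le_add_right (Real.arccos_le_arccos (Real.sqrt_le_sqrt hle)) _)

lemma theta_le (Q : QCGDP Ξ H A B) (z : B × R) {Ψ : Op (A × R) →ₗ[ℂ] Op (B × R)}
    (hΨ : IsChannel Ψ) {m n : ℕ} (hmn : m ≤ n) :
    Q.theta z n ≤ ((n : ℝ) - m) * Q.thetaA Ψ + Q.theta z m := by
  induction n, hmn using Nat.le_induction with
  | base => simp
  | succ n _ ih =>
    have := Q.theta_succ_le z hΨ n
    push_cast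
    linarith

theorem cos_sq_le_pErr (Q : QCGDP Ξ H A B) (z : B × R) {Ψ : Op (A × R) →ₗ[ℂ] Op (B × R)}
    (hΨ : IsChannel Ψ) {m n : ℕ} (hmn : m ≤ n)
    (h : ((n : ℝ) - m) * Q.thetaA Ψ + Q.theta z m ≤ Real.pi / 2) :
    Real.cos (((n : ℝ) - m) * Q.thetaA Ψ + Q.theta z m) ^ 2 ≤ Q.pErr z n := by
  have hle := Q.theta_le z hΨ hmn
  have h0 : 0 ≤ Q.theta z n := Real.arccos_nonneg _
  have hp := Q.pErr_mem_Icc z n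
  have hcos := Real.cos_le_cos_of_nonneg_of_le_pi h0 (by linarith [Real.pi_pos]) hle
  have hnonneg := Real.cos_nonneg_of_neg_pi_div_two_le_of_le
    (by linarith [Real.pi_pos] : -(Real.pi / 2) ≤ ((n : ℝ) - m) * Q.thetaA Ψ + Q.theta z m) h
  have hn : Real.cos (Q.theta z n) = √(Q.pErr z n) :=
    Real.cos_arccos (by linarith [Real.sqrt_nonneg (Q.pErr z n)]) (Real.sqrt_le_one.2 hp.2)
  rw [hn] at hcos
  calc _ ≤ √(Q.pErr z n) ^ 2 := by gcongr
    _ = _ := Real.sq_sqrt hp.1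

end QCGDP

/-! ### The averaged fidelity in terms of Stinespring representations -/

section Stinespring

variable {A B E R : Type*} [Fintype A] [DecidableEq A] [Fintype B] [Fintype E] [Fintype R]

/-- The vector `(V ⊗ 1) φ` of `B ⊗ E ⊗ R`, as a matrix from `E` to `B ⊗ R`. -/
def dilate (V : Matrix (B × E) A ℂ) (φ : A × R → ℂ) : Matrix (B × R) E ℂ :=
  Matrix.of fun i e => ∑ a, V (i.1, e) a * φ (a, i.2)

omit [Fintype R] in
lemma IsStinespring.tensorId_ketBra {Φ : Op A →ₗ[ℂ] Op B} {V : Matrix (B × E) A ℂ}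
    (h : IsStinespring Φ V) (φ : A × R → ℂ) :
    tensorId R Φ (ketBra φ) = dilate V φ * (dilate V φ)ᴴ := by
  ext i j
  have h1 : (Matrix.of fun a a' => ketBra φ (a, i.2) (a', j.2)) =
      vecMulVec (fun a => φ (a, i.2)) (star fun a => φ (a, j.2)) := rfl
  change Φ (Matrix.of fun a a' => ketBra φ (a, i.2) (a', j.2)) i.1 j.1 = _
  rw [h1, h.2, mul_vecMulVec, vecMulVec_mul, ← star_mulVec]
  simp [traceSnd, vecMulVec_apply, mul_apply, dilate, mulVec, dotProduct]

lemma traceNorm_conjTranspose {N : Type*} [Fintype N] [DecidableEq N] (L : Op N) :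
    traceNorm Lᴴ = traceNorm L := by
  rw [traceNorm_eq_of_conjTranspose_mul, conjTranspose_conjTranspose, traceNorm]

lemma fidelity_tensorId_ketBra [DecidableEq B] [DecidableEq R] [DecidableEq E]
    {Φ Ψ : Op A →ₗ[ℂ] Op B} {W V : Matrix (B × E) A ℂ} (hW : IsStinespring Φ W)
    (hV : IsStinespring Ψ V) (φ : A × R → ℂ) :
    fidelity (tensorId R Φ (ketBra φ)) (tensorId R Ψ (ketBra φ)) =
      traceNorm (traceFst (W * traceSnd (ketBra φ) * Vᴴ)) := by
  have h : traceFst (W * traceSnd (ketBra φ) * Vᴴ) = ((dilate V φ)ᴴ * dilate W φ)ᵀ := by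
    have h1 : traceSnd (ketBra φ) =
        ∑ r, vecMulVec (fun a => φ (a, r)) (star fun a => φ (a, r)) := by
      ext a a'
      simp [traceSnd, ketBra, vecMulVec_apply, Matrix.sum_apply]
    rw [h1, Matrix.mul_sum, Matrix.sum_mul]
    simp only [mul_vecMulVec, vecMulVec_mul, ← star_mulVec]
    ext e e'
    simp only [traceFst, of_apply, Matrix.sum_apply, vecMulVec_apply, transpose_apply, mul_apply,
      Fintype.sum_prod_type, conjTranspose_apply]
    exact Finset.sum_congr rfl fun b _ => Finset.sum_congr rfl fun r _ => mul_comm _ _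
  rw [hW.tensorId_ketBra, hV.tensorId_ketBra, fidelity_mul_conjTranspose, h, traceNorm_transpose,
    ← traceNorm_conjTranspose, conjTranspose_mul, conjTranspose_conjTranspose]

omit [DecidableEq A] in
lemma isDensity_traceSnd {X : Op (A × R)} (hX : IsDensity X) : IsDensity (traceSnd X) := by
  constructor
  · have h : traceSnd X = ∑ r, X.submatrix (fun a => (a, r)) fun a => (a, r) := by
      ext a a'
      simp [traceSnd, Matrix.sum_apply]
    rw [h]
    exact posSemidef_sum _ fun r _ => hX.1.submatrix _
  · rw [← hX.2]
    simp [trace, traceSnd, Fintype.sum_prod_type]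

/-- Every density operator on `A` has a purification in `A ⊗ R` if `dim A ≤ dim R`. -/
lemma IsDensity.exists_purification {σ : Op A} (hσ : IsDensity σ)
    (hR : Fintype.card A ≤ Fintype.card R) :
    ∃ φ : A × R → ℂ, IsStateVector φ ∧ traceSnd (ketBra φ) = σ := by
  obtain ⟨f⟩ := Function.Embedding.nonempty_of_card_le hR
  set s := CFC.sqrt σ
  have hs : s * sᴴ = σ := by
    rw [(CFC.sqrt_nonneg σ).posSemidef.1]
    exact CFC.sqrt_mul_sqrt_self _ hσ.1.nonneg
  set φ : A × R → ℂ := fun q => Function.extend f (s q.1) 0 q.2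
  have h : traceSnd (ketBra φ) = σ := by
    rw [← hs]
    ext a a'
    simp only [traceSnd, of_apply, mul_apply, ketBra, vecMulVec_apply]
    refine (Fintype.sum_of_injective f f.injective _ _ (fun r hr => ?_) fun b => ?_).symm
    · simp [φ, Function.extend_apply' _ _ _ hr]
    · simp [φ, f.injective.extend_apply]
  refine ⟨φ, ?_, h⟩
  have htr := congrArg trace h
  rw [hσ.2] at htr
  rw [IsStateVector, ← htr, dotProduct, trace, Fintype.sum_prod_type]
  exact Finset.sum_congr rfl fun a _ => Finset.sum_congr rfl fun r _ => mul_comm _ _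

/-- The reduced state of a pure state of `A ⊗ R` ranges over all density operators on `A`, and the
fidelities only depend on it. -/
lemma QCGDP.avgFidelities_tensorId {Ξ H : Type*} [Fintype Ξ] [DecidableEq B] [DecidableEq R]
    [DecidableEq E] (Q : QCGDP Ξ H A B) (hR : Fintype.card A ≤ Fintype.card R)
    {Ψ : Op A →ₗ[ℂ] Op B} {W : Ξ → Matrix (B × E) A ℂ} {V : Matrix (B × E) A ℂ}
    (hW : ∀ ξ, IsStinespring (Q.O ξ) (W ξ)) (hV : IsStinespring Ψ V) :
    Q.avgFidelities (tensorId R Ψ) = Q.avgTraceNorms W V := by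
  ext f
  constructor
  · rintro ⟨φ, hφ, rfl⟩
    exact ⟨_, isDensity_traceSnd (isDensity_ketBra hφ),
      by simp only [fidelity_tensorId_ketBra (hW _) hV]⟩
  · rintro ⟨σ, hσ, rfl⟩
    obtain ⟨φ, hφ, rfl⟩ := hσ.exists_purification hR
    exact ⟨φ, hφ, by simp only [fidelity_tensorId_ketBra (hW _) hV]⟩

end Stinespring

end QuantumDiscrimination

theorem theorem1 {Ξ H A B R : Type*} [Fintype Ξ] [DecidableEq Ξ] [Fintype H] [Nonempty H]
    [Fintype A] [DecidableEq A] [Nonempty A] [Fintype B] [DecidableEq B] [Fintype R]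
    [DecidableEq R] (Q : QuantumDiscrimination.QCGDP Ξ H A B) (z : B × R) :
    -- the minima defining `p_err(n)` and `θ_𝒜(Ψ)` are attained
    (∀ n : ℕ, IsLeast (Q.errorProbs z n) (Q.pErr z n)) ∧
    (∀ Ψ : QuantumDiscrimination.Op (A × R) →ₗ[ℂ] QuantumDiscrimination.Op (B × R),
      QuantumDiscrimination.IsChannel Ψ →
        IsLeast (Q.avgFidelities Ψ) (sInf (Q.avgFidelities Ψ))) ∧
    -- the lower bound
    (∀ Ψ : QuantumDiscrimination.Op (A × R) →ₗ[ℂ] QuantumDiscrimination.Op (B × R),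
      QuantumDiscrimination.IsChannel Ψ → ∀ m n : ℕ, m ≤ n →
        ((n : ℝ) - (m : ℝ)) * Q.thetaA Ψ + Q.theta z m ∈ Set.Icc 0 (Real.pi / 2) →
          Real.cos (((n : ℝ) - (m : ℝ)) * Q.thetaA Ψ + Q.theta z m) ^ 2 ≤ Q.pErr z n) ∧
    -- the formula for `θ_𝒜(Ψ ⊗ id)`
    (Fintype.card A ≤ Fintype.card R →
      ∀ Ψ : QuantumDiscrimination.Op A →ₗ[ℂ] QuantumDiscrimination.Op B,
        QuantumDiscrimination.IsChannel Ψ →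
          ∀ (E : Type*) [Fintype E] [DecidableEq E] (W : Ξ → Matrix (B × E) A ℂ)
            (V : Matrix (B × E) A ℂ),
            (∀ ξ, QuantumDiscrimination.IsStinespring (Q.O ξ) (W ξ)) →
              QuantumDiscrimination.IsStinespring Ψ V →
                IsLeast (Q.avgTraceNorms W V) (sInf (Q.avgTraceNorms W V)) ∧
                  Q.thetaA (QuantumDiscrimination.tensorId R Ψ) =
                    Real.arccos (sInf (Q.avgTraceNorms W V))) := by
  have : Nonempty R := ⟨z.2⟩
  refine ⟨Q.isLeast_pErr z, fun Ψ hΨ => Q.isLeast_avgFidelities hΨ,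
    fun Ψ hΨ m n hmn h => Q.cos_sq_le_pErr z hΨ hmn h.2, ?_⟩
  intro hR Ψ hΨ E _ _ W V hW hV
  rw [← Q.avgFidelities_tensorId hR hW hV]
  exact ⟨Q.isLeast_avgFidelities hΨ.tensorId, rfl⟩
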